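/- Write $\widehat f(\xi)=\int f(t)e^{-2\pi i t\xi}\,dt$ for the Fourier transform on $L^2(\mathbb R)$ (extended unitarily). For $p>1$ and $h\in L^2(\mathbb R)$ with $\|h\|_2=1$, let $$\Delta_p(h)=\inf_{a\in\mathbb R}\Big(\int_{\mathbb R}|t-a|^p|h(t)|^2\,dt\Big)^{1/2}\in[0,\infty],$$ and, when $\Delta_p(h)<\infty$, let $\mu_p(h)\in\mathbb R$ be the unique point $a$ at which this infimum is attained. A sequence $\{e_n\}_{n=1}^\infty$ in $L^2(\mathbb R)$ is a frame for $L^2(\mathbb R)$ if there are constants $0<c,C<\infty$ such that $$c\|f\|_2^2\le\sum_{n=1}^\infty|\langle f,e_n\rangle|^2\le C\|f\|_2^2\quad\text{for all } f\in L^2(\mathbb R).$$ Corollary 4.4. Fix $A>0$ and $p,q>1$. If $\{e_n\}_{n=1}^\infty\subset L^2(\mathbb R)$ satisfies $\|e_n\|_2=1$ and $$|\mu_p(e_n)|\le A,\qquad \Delta_p(e_n)\le A,\qquad \Delta_q(\widehat{e_n})\le A\qquad\text{for all } n\in\mathbb N$$ (in particular, these dispersions are finite), then $\{e_n\}_{n=1}^\infty$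 is not a frame for $L^2(\mathbb R)$. -/

import Mathlib

open MeasureTheory
open scoped ENNReal FourierTransform

/-- A sequence `e` in a complex Hilbert space is a frame if there are constants `0 < A, B < ∞` with
`A ‖f‖² ≤ ∑ₙ |⟨f, eₙ⟩|² ≤ B ‖f‖²` for every vector `f`. -/
def IsFrame {H : Type*} [NormedAddCommGroup H] [InnerProductSpace ℂ H] (e : ℕ → H) : Prop :=
  ∃ A B : ℝ, 0 < A ∧ 0 < B ∧ ∀ f : H,
    Summable (fun n => ‖inner ℂ f (e n)‖ ^ 2) ∧
    A * ‖f‖ ^ 2 ≤ ∑' n, ‖inner ℂ f (e n)‖ ^ 2 ∧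
    ∑' n, ‖inner ℂ f (e n)‖ ^ 2 ≤ B * ‖f‖ ^ 2

/-- The spread `(∫ |t - a|^p |h(t)|² dt)^{1/2} ∈ [0, ∞]` of `h` around the point `a`. -/
noncomputable def pSpread (p : ℝ) (h : ℝ → ℂ) (a : ℝ) : ℝ≥0∞ :=
  (∫⁻ t : ℝ, ENNReal.ofReal (|t - a| ^ p * ‖h t‖ ^ 2)) ^ (1 / 2 : ℝ)

/-- The `p`-dispersion `Δ_p(h)`, the smallest spread of `h` around a point. It takes the value `∞`
if all the spreads are infinite. -/
noncomputable def pDispersion (p : ℝ) (h : ℝ → ℂ) : ℝ≥0∞ :=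
  ⨅ a : ℝ, pSpread p h a

/-- The `p`-mean `μ_p(h)`, the point around which the spread of `h` is smallest. For `p > 1`,
`‖h‖₂ = 1` and `Δ_p(h) < ∞` this minimizer exists and is unique, by strict convexity and coercivity
of `a ↦ ∫ |t - a|^p |h(t)|² dt`. If `Δ_p(h) = ∞` the value carries no information. -/
noncomputable def pMean (p : ℝ) (h : ℝ → ℂ) : ℝ :=
  Classical.epsilon fun a : ℝ => ∀ b : ℝ, pSpread p h a ≤ pSpread p h b

/-! Pass to the frequency side, where `𝓕 (e n)` is again a frame, and give each one a center `b n`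
of bounded spread. The time centers stay in `[-A, A]`, so all `e n` with `⌊b n⌋ = k` are essentially
concentrated in one time-frequency box of fixed area. The upper frame bound then caps their number
uniformly in `k` (`card_le_of_concentrated`). Test the frame against the unit vectors `truncExp 0 1
t`. As `t → ∞` each coefficient tends to zero by Riemann–Lebesgue. Each squared coefficient is
bounded, uniformly in `t`, by the energy of `𝓕 (e n)` on `[0, 1]`, which is `O(|k|^(-q))`. Since `q
> 1` and each `k` occurs boundedly often, dominated convergence sends the frame sum to `0`,
contradicting the lower frame bound. -/

/-! ### Spreads, tails and attainment of the mean -/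

theorem pSpread_sq (p : ℝ) (h : ℝ → ℂ) (a : ℝ) :
    pSpread p h a ^ 2 = ∫⁻ t : ℝ, ENNReal.ofReal (|t - a| ^ p * ‖h t‖ ^ 2) := by
  rw [pSpread, ← ENNReal.rpow_natCast, ← ENNReal.rpow_mul]
  norm_num

theorem eLpNorm_two_sq {μ : Measure ℝ} (h : ℝ → ℂ) :
    eLpNorm h 2 μ ^ 2 = ∫⁻ t, ‖h t‖ₑ ^ 2 ∂μ := by
  have := eLpNorm_nnreal_pow_eq_lintegral (f := h) (μ := μ) (p := 2) two_ne_zero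
  simpa only [NNReal.coe_ofNat, ENNReal.rpow_ofNat, ENNReal.coe_ofNat] using this

/-- Chebyshev's inequality for the spread around `a`. -/
theorem ofReal_rpow_mul_eLpNorm_sq_le {p : ℝ} (hp : 0 ≤ p) (h : ℝ → ℂ) {a r : ℝ} (hr : 0 ≤ r)
    {S : Set ℝ} (hS : MeasurableSet S) (hSr : ∀ t ∈ S, r ≤ |t - a|) :
    ENNReal.ofReal (r ^ p) * eLpNorm h 2 (volume.restrict S) ^ 2 ≤ pSpread p h a ^ 2 := by
  rw [eLpNorm_two_sq, pSpread_sq, ← lintegral_const_mul' _ _ ENNReal.ofReal_ne_top]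
  refine (setLIntegral_mono' hS fun t ht => ?_).trans (setLIntegral_le_lintegral S _)
  rw [← ofReal_norm, ← ENNReal.ofReal_pow (norm_nonneg _),
    ← ENNReal.ofReal_mul (by positivity)]
  exact ENNReal.ofReal_le_ofReal (mul_le_mul_of_nonneg_right
    (Real.rpow_le_rpow hr (hSr t ht) hp) (by positivity))

/-- Functions of bounded spread have uniformly small tails. -/
theorem exists_radius_eLpNorm_le {p : ℝ} (hp : 0 < p) {D ε : ℝ} (hD : 0 ≤ D) (hε : 0 < ε) :
    ∃ r : ℝ, 0 < r ∧ ∀ (h : ℝ → ℂ) (a : ℝ) (S : Set ℝ), MeasurableSet S →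
      (∀ t ∈ S, r ≤ |t - a|) → pSpread p h a ≤ ENNReal.ofReal D →
        eLpNorm h 2 (volume.restrict S) ≤ ENNReal.ofReal ε := by
  have hpos : 0 < (D / ε) ^ 2 + 1 := by positivity
  -- The radius satisfies `r ^ p * ε ^ 2 = D ^ 2 + ε ^ 2 > D ^ 2`, which contradicts Chebyshev if
  -- the tail exceeds `ε`.
  refine ⟨((D / ε) ^ 2 + 1) ^ (1 / p), by positivity, fun h a S hS hSr hD' => ?_⟩
  by_contra! hlt
  have h1 := ofReal_rpow_mul_eLpNorm_sq_le hp.le h (by positivity) hS hSr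
  rw [← Real.rpow_mul hpos.le, one_div_mul_cancel hp.ne', Real.rpow_one] at h1
  have h2 : ENNReal.ofReal (((D / ε) ^ 2 + 1) * ε ^ 2) ≤ ENNReal.ofReal (D ^ 2) := by
    rw [ENNReal.ofReal_mul hpos.le, ENNReal.ofReal_pow hε.le, ENNReal.ofReal_pow hD]
    calc _ ≤ _ := by gcongr
      _ ≤ _ := h1
      _ ≤ _ := by gcongr
  rw [ENNReal.ofReal_le_ofReal_iff (by positivity)] at h2
  have h3 : ((D / ε) ^ 2 + 1) * ε ^ 2 = D ^ 2 + ε ^ 2 := by field_simp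
  nlinarith [pow_pos hε 2]

theorem eLpNorm_le_restrict_add_compl {h : ℝ → ℂ} (hm : AEStronglyMeasurable h volume)
    {S : Set ℝ} (hS : MeasurableSet S) :
    eLpNorm h 2 volume ≤
      eLpNorm h 2 (volume.restrict S) + eLpNorm h 2 (volume.restrict Sᶜ) := by
  rw [← eLpNorm_indicator_eq_eLpNorm_restrict hS,
    ← eLpNorm_indicator_eq_eLpNorm_restrict hS.compl]
  conv_lhs => rw [← Set.indicator_self_add_compl S h]
  exact eLpNorm_add_le (hm.indicator hS) (hm.indicator hS.compl) one_le_two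

/-- Fatou's lemma, as the integrand is continuous in the center. This suffices for a minimum on a
compact set, even where the spread is infinite. -/
theorem lowerSemicontinuous_pSpread {p : ℝ} (hp : 0 ≤ p) {h : ℝ → ℂ}
    (hm : AEStronglyMeasurable h volume) : LowerSemicontinuous (pSpread p h) := by
  have hcont : ∀ t : ℝ, Continuous fun a : ℝ => ENNReal.ofReal (|t - a| ^ p * ‖h t‖ ^ 2) :=
    fun t => ENNReal.continuous_ofReal.comp
      (((Real.continuous_rpow_const hp).comp (by fun_prop)).mul continuous_const)
  have hlsc : LowerSemicontinuous
      fun a : ℝ => ∫⁻ t : ℝ, ENNReal.ofReal (|t - a| ^ p * ‖h t‖ ^ 2) := by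
    rw [lowerSemicontinuous_iff_le_liminf]
    intro a
    calc ∫⁻ t : ℝ, ENNReal.ofReal (|t - a| ^ p * ‖h t‖ ^ 2)
        = ∫⁻ t : ℝ, Filter.liminf (fun b => ENNReal.ofReal (|t - b| ^ p * ‖h t‖ ^ 2))
            (nhds a) := by
          refine lintegral_congr fun t => ((hcont t).tendsto a).liminf_eq.symm
      _ ≤ _ := by
          refine lintegral_liminf_le' fun b => ?_
          have : Measurable fun t : ℝ => |t - b| ^ p := by fun_prop
          exact (this.aemeasurable.mul (hm.norm.aemeasurable.pow_const 2)).ennreal_ofReal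
  exact (ENNReal.continuous_rpow_const).comp_lowerSemicontinuous hlsc
    (ENNReal.monotone_rpow_of_nonneg (by norm_num))

/-- A function of norm one and finite dispersion has a point of smallest spread. -/
theorem exists_forall_pSpread_le {p : ℝ} (hp : 0 < p) {h : ℝ → ℂ}
    (hm : AEStronglyMeasurable h volume) (h1 : eLpNorm h 2 volume = 1)
    (hfin : pDispersion p h < ∞) : ∃ a, ∀ b, pSpread p h a ≤ pSpread p h b := by
  obtain ⟨a₀, ha₀⟩ := iInf_lt_iff.1 hfin
  set D := (pSpread p h a₀).toReal
  have hD : pSpread p h a₀ = ENNReal.ofReal D := (ENNReal.ofReal_toReal ha₀.ne).symm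
  have hD0 : 0 ≤ D := ENNReal.toReal_nonneg
  obtain ⟨r, hr, htail⟩ := exists_radius_eLpNorm_le hp hD0 (ε := 1 / 2) (by norm_num)
  set S := Metric.ball a₀ r
  have hS : MeasurableSet S := measurableSet_ball
  have hmass : ENNReal.ofReal (1 / 2) ≤ eLpNorm h 2 (volume.restrict S) := by
    have h2 := htail h a₀ Sᶜ hS.compl (fun t ht => by
      simpa [S, Real.dist_eq] using ht) hD.le
    have h3 := (h1.symm.le.trans (eLpNorm_le_restrict_add_compl hm hS)).trans
      (add_le_add_right h2 _)
    by_contra! hlt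
    have h4 : (1 : ℝ≥0∞) < ENNReal.ofReal (1 / 2) + ENNReal.ofReal (1 / 2) :=
      h3.trans_lt (ENNReal.add_lt_add_right ENNReal.ofReal_ne_top hlt)
    rw [← ENNReal.ofReal_add (by norm_num) (by norm_num)] at h4
    norm_num at h4
  -- Coercivity: a center farther than `r + ρ` from `a₀` with spread at most `D` would leave norm at
  -- most `1/4` on `S`, which carries at least `1/2`. So a minimizer on the closed ball is global.
  obtain ⟨ρ, hρ, hfar⟩ := exists_radius_eLpNorm_le hp hD0 (ε := 1 / 4) (by norm_num)
  obtain ⟨a, -, ha⟩ := ((lowerSemicontinuous_pSpread hp.le hm).lowerSemicontinuousOn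
    (Metric.closedBall a₀ (r + ρ))).exists_isMinOn
    ⟨a₀, Metric.mem_closedBall_self (by positivity)⟩ (isCompact_closedBall _ _)
  refine ⟨a, fun b => ?_⟩
  by_cases hb : b ∈ Metric.closedBall a₀ (r + ρ)
  · exact ha hb
  refine (ha (Metric.mem_closedBall_self (by positivity))).trans ?_
  by_contra! hlt
  have h5 := hfar h b S hS (fun t ht => by
    rw [Metric.mem_closedBall, not_le, dist_comm] at hb
    have ht' : dist a₀ t < r := by rw [dist_comm]; exact ht
    have := dist_triangle a₀ t b
    rw [← Real.dist_eq]
    linarith) (hlt.le.trans hD.le)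
  have h6 := hmass.trans h5
  rw [ENNReal.ofReal_le_ofReal_iff (by norm_num)] at h6
  norm_num at h6

theorem pSpread_pMean_le {p : ℝ} (hp : 0 < p) {h : ℝ → ℂ}
    (hm : AEStronglyMeasurable h volume) (h1 : eLpNorm h 2 volume = 1)
    (hfin : pDispersion p h < ∞) : pSpread p h (pMean p h) ≤ pDispersion p h :=
  le_iInf (Classical.epsilon_spec (exists_forall_pSpread_le hp hm h1 hfin))

/-! ### The inverse Fourier transform on `L¹ ∩ L²` -/

theorem integral_fourier_mul_eq {f g : ℝ → ℂ} (hf : Integrable f) (hg : Integrable g) :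
    ∫ x, 𝓕 f x * g x = ∫ x, f x * 𝓕 g x := by
  have := VectorFourier.integral_fourierIntegral_smul_eq_flip (e := Real.fourierChar)
    (L := innerₗ ℝ) Real.continuous_fourierChar (by exact continuous_inner) hf hg
  rw [flip_innerₗ] at this
  exact this

theorem integral_fourierInv_mul_eq {f g : ℝ → ℂ} (hf : Integrable f) (hg : Integrable g) :
    ∫ x, 𝓕⁻ f x * g x = ∫ x, f x * 𝓕⁻ g x := by
  rw [Real.fourierInv_eq_fourier_comp_neg g, ← integral_fourier_mul_eq hf hg.comp_neg,
    ← integral_neg_eq_self]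
  simp [Real.fourierInv_eq_fourier_neg]

theorem continuous_fourierInv_of_integrable {f : ℝ → ℂ} (hf : Integrable f) :
    Continuous (𝓕⁻ f : ℝ → ℂ) := by
  rw [Real.fourierInv_eq_fourier_comp_neg f]
  exact VectorFourier.fourierIntegral_continuous (L := innerₗ ℝ) Real.continuous_fourierChar
    (by exact continuous_inner) hf.comp_neg

/-- On `L¹ ∩ L²` the unitary inverse Fourier transform is given by the integral. -/
theorem coeFn_fourierInv_ae_eq (u : Lp ℂ 2 (volume : Measure ℝ)) (hu : Integrable u) :
    (𝓕⁻ u : Lp ℂ 2 (volume : Measure ℝ)) =ᵐ[volume] (𝓕⁻ (u : ℝ → ℂ) : ℝ → ℂ) := by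
  refine ae_eq_of_integral_contDiff_smul_eq ((Lp.memLp _).locallyIntegrable one_le_two)
    (continuous_fourierInv_of_integrable hu).locallyIntegrable fun φ hφ hφc => ?_
  have hc : HasCompactSupport (Complex.ofRealCLM ∘ φ) := hφc.comp_left rfl
  have hd : ContDiff ℝ (↑(⊤ : ℕ∞)) (Complex.ofRealCLM ∘ φ) := by fun_prop
  set ψ := hc.toSchwartzMap hd
  -- The unitary and the distributional inverse transforms agree; the latter moves onto the test
  -- function, and Fubini moves it back as an integral.
  have h1 : (𝓕⁻ (Lp.toTemperedDistribution u)) ψ =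
      Lp.toTemperedDistribution (𝓕⁻ u : Lp ℂ 2 (volume : Measure ℝ)) ψ := by
    rw [Lp.fourierInv_toTemperedDistribution_eq]
  rw [TemperedDistribution.fourierInv_apply, Lp.toTemperedDistribution_apply,
    Lp.toTemperedDistribution_apply] at h1
  simp only [SchwartzMap.fourierInv_coe, smul_eq_mul] at h1
  rw [integral_fourierInv_mul_eq ψ.integrable hu] at h1
  simpa [ψ] using h1.symm

/-! ### Truncated exponentials as test vectors -/

/-- The truncated exponential `ξ ↦ 1_[a,b](ξ) e^{-2πitξ}`. -/
noncomputable def truncExp (a b t : ℝ) : ℝ → ℂ :=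
  (Set.Icc a b).indicator fun ξ => (Real.fourierChar (-(ξ * t)) : ℂ)

theorem memLp_truncExp (a b t : ℝ) : MemLp (truncExp a b t) 2 volume := by
  refine (memLp_indicator_iff_restrict measurableSet_Icc).2 ?_
  refine MemLp.of_bound (C := 1) ?_ (Filter.Eventually.of_forall fun ξ => (Circle.norm_coe _).le)
  exact Continuous.aestronglyMeasurable (continuous_subtype_val.comp
    (Real.continuous_fourierChar.comp (by fun_prop)))

theorem norm_truncExp_sq {a b : ℝ} (hab : a ≤ b) (t : ℝ) :
    ‖(memLp_truncExp a b t).toLp‖ ^ 2 = b - a := by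
  have h : eLpNorm (truncExp a b t) 2 volume ^ 2 = ENNReal.ofReal (b - a) := by
    rw [truncExp, eLpNorm_indicator_eq_eLpNorm_restrict measurableSet_Icc, eLpNorm_two_sq]
    simp only [← ofReal_norm, Circle.norm_coe]
    simp
  rw [Lp.norm_toLp, ← ENNReal.toReal_pow, h, ENNReal.toReal_ofReal (by linarith)]

/-- This identity gives the frame coefficients two readings: values at time `t` of a band-limited
function, and integrals to which Riemann–Lebesgue applies. -/
theorem inner_truncExp (a b t : ℝ) (g : Lp ℂ 2 (volume : Measure ℝ)) :
    inner ℂ (memLp_truncExp a b t).toLp g = 𝓕⁻ ((Set.Icc a b).indicator g) t := by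
  rw [L2.inner_def, Real.fourierInv_eq]
  refine integral_congr_ae ((memLp_truncExp a b t).coeFn_toLp.mono fun ξ hξ => ?_)
  beta_reduce
  rw [hξ, truncExp]
  by_cases h : ξ ∈ Set.Icc a b
  · rw [Set.indicator_of_mem h, Set.indicator_of_mem h, RCLike.inner_apply,
      ← Circle.coe_inv_eq_conj, AddChar.map_neg_eq_inv, inv_inv, Circle.smul_def, smul_eq_mul,
      mul_comm (g ξ), Real.inner_apply]
  · simp [h]

theorem integrable_indicator_Icc (a b : ℝ) (g : Lp ℂ 2 (volume : Measure ℝ)) :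
    Integrable ((Set.Icc a b).indicator g) := by
  rw [integrable_indicator_iff measurableSet_Icc]
  exact integrableOn_Lp_of_measure_ne_top g one_le_two (by simp)

theorem tendsto_inner_truncExp (a b : ℝ) (g : Lp ℂ 2 (volume : Measure ℝ)) :
    Filter.Tendsto (fun t => inner ℂ (memLp_truncExp a b t).toLp g) Filter.atTop (nhds 0) := by
  simp only [inner_truncExp, Real.fourierInv_eq_fourier_comp_neg]
  exact (Real.zero_at_infty_fourier _).mono_left atTop_le_cocompact

/-- Cauchy–Schwarz on an interval of length one. The bound does not depend on `t`, as domination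
requires. -/
theorem norm_inner_truncExp_le (t : ℝ) (g : Lp ℂ 2 (volume : Measure ℝ)) :
    ‖inner ℂ (memLp_truncExp 0 1 t).toLp g‖ₑ ≤
      eLpNorm g 2 (volume.restrict (Set.Icc (0 : ℝ) 1)) := by
  have : IsProbabilityMeasure (volume.restrict (Set.Icc (0 : ℝ) 1)) := ⟨by simp⟩
  rw [inner_truncExp, Real.fourierInv_eq]
  calc _ ≤ _ := enorm_integral_le_lintegral_enorm _
    _ = eLpNorm g 1 (volume.restrict (Set.Icc (0 : ℝ) 1)) := by
      rw [← eLpNorm_indicator_eq_eLpNorm_restrict measurableSet_Icc,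
        eLpNorm_one_eq_lintegral_enorm]
      simp [← ofReal_norm, Circle.norm_smul]
    _ ≤ _ := eLpNorm_le_eLpNorm_of_exponent_le one_le_two
      (Lp.aestronglyMeasurable g).restrict

/-! ### Counting vectors concentrated in a time-frequency box -/

/-- A unit vector essentially concentrated on `T`, with Fourier transform essentially concentrated
on `[a, b]`, keeps a quarter of its energy after truncation to `[a, b]` and then to `T`. -/
theorem quarter_le_setLIntegral_inner_truncExp {h : Lp ℂ 2 (volume : Measure ℝ)} (h1 : ‖h‖ = 1)
    {a b : ℝ} {T : Set ℝ} (hT : MeasurableSet T)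
    (htime : eLpNorm h 2 (volume.restrict Tᶜ) ≤ ENNReal.ofReal (1 / 4))
    (hfreq : eLpNorm (𝓕 h : Lp ℂ 2 (volume : Measure ℝ)) 2 (volume.restrict (Set.Icc a b)ᶜ) ≤
      ENNReal.ofReal (1 / 4)) :
    ENNReal.ofReal (1 / 4) ≤
      ∫⁻ t in T, ‖inner ℂ (memLp_truncExp a b t).toLp (𝓕 h : Lp ℂ 2 (volume : Measure ℝ))‖ₑ ^ 2 := by
  set g : Lp ℂ 2 (volume : Measure ℝ) := 𝓕 h
  have hmem : MemLp ((Set.Icc a b).indicator g) 2 volume := (Lp.memLp g).indicator measurableSet_Icc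
  set u : Lp ℂ 2 (volume : Measure ℝ) := hmem.toLp
  have hu : u =ᵐ[volume] (Set.Icc a b).indicator g := hmem.coeFn_toLp
  have huint : Integrable u := (integrable_indicator_Icc a b g).congr hu.symm
  set w : Lp ℂ 2 (volume : Measure ℝ) := 𝓕⁻ u
  have hw : w =ᵐ[volume] (𝓕⁻ ((Set.Icc a b).indicator g) : ℝ → ℂ) := by
    refine (coeFn_fourierInv_ae_eq u huint).trans (Filter.Eventually.of_forall fun t => ?_)
    simp only [Real.fourierInv_eq]
    exact integral_congr_ae (hu.mono fun ξ hξ => by simp only [hξ])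
  -- By Plancherel, the error of band-limiting equals the frequency tail.
  have hwh : eLpNorm (h - w : Lp ℂ 2 (volume : Measure ℝ)) 2 volume ≤ ENNReal.ofReal (1 / 4) := by
    have e1 : ‖h - w‖ = ‖g - u‖ := by
      have e2 : g - u = 𝓕 (h - w) := by
        have hFw : 𝓕 w = u := FourierTransform.fourier_fourierInv_eq u
        rw [← hFw]
        exact (map_sub (Lp.fourierTransformₗᵢ ℝ ℂ) h w).symm
      rw [e2, Lp.norm_fourier_eq]
    rw [← Lp.enorm_def, ← ofReal_norm, e1, ofReal_norm, Lp.enorm_def]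
    refine le_trans (le_of_eq ?_) hfreq
    rw [← eLpNorm_indicator_eq_eLpNorm_restrict measurableSet_Icc.compl]
    refine eLpNorm_congr_ae ((Lp.coeFn_sub g u).trans (hu.mono fun ξ hξ => ?_))
    by_cases hm : ξ ∈ Set.Icc a b <;> simp [hξ, hm]
  have h0 : eLpNorm h 2 volume = 1 := by
    rw [← Lp.enorm_def, ← ofReal_norm, h1, ENNReal.ofReal_one]
  have hsplit : eLpNorm h 2 (volume.restrict T) ≤
      eLpNorm (h - w : Lp ℂ 2 (volume : Measure ℝ)) 2 (volume.restrict T) +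
        eLpNorm w 2 (volume.restrict T) := by
    refine le_trans (le_of_eq (eLpNorm_congr_ae ?_)) (eLpNorm_add_le
      (Lp.aestronglyMeasurable _).restrict (Lp.aestronglyMeasurable _).restrict one_le_two)
    refine ae_restrict_of_ae ((Lp.coeFn_sub h w).mono fun t ht => ?_)
    rw [Pi.add_apply, ht, Pi.sub_apply, sub_add_cancel]
  have hwT : ENNReal.ofReal (1 / 2) ≤ eLpNorm w 2 (volume.restrict T) := by
    -- The two errors of `1/4` leave norm at least `1/2` on `T`, hence energy at least `1/4`.
    have h2 : (1 : ℝ≥0∞) ≤ ENNReal.ofReal (1 / 4) + eLpNorm w 2 (volume.restrict T) +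
        ENNReal.ofReal (1 / 4) := by
      rw [← h0]
      refine (eLpNorm_le_restrict_add_compl (Lp.aestronglyMeasurable h) hT).trans ?_
      gcongr
      refine hsplit.trans ?_
      gcongr
      exact (eLpNorm_mono_measure _ Measure.restrict_le_self).trans hwh
    by_contra! hlt
    have h3 : (1 : ℝ≥0∞) < ENNReal.ofReal (1 / 4) + ENNReal.ofReal (1 / 2) +
        ENNReal.ofReal (1 / 4) :=
      h2.trans_lt (ENNReal.add_lt_add_right ENNReal.ofReal_ne_top
        (ENNReal.add_lt_add_left ENNReal.ofReal_ne_top hlt))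
    rw [← ENNReal.ofReal_add (by norm_num) (by norm_num),
      ← ENNReal.ofReal_add (by norm_num) (by norm_num)] at h3
    norm_num at h3
  calc ENNReal.ofReal (1 / 4) = ENNReal.ofReal (1 / 2) ^ 2 := by
        rw [← ENNReal.ofReal_pow (by norm_num)]; norm_num
    _ ≤ eLpNorm w 2 (volume.restrict T) ^ 2 := by gcongr
    _ = _ := by
      rw [eLpNorm_two_sq]
      refine lintegral_congr_ae (ae_restrict_of_ae (hw.mono fun t ht => ?_))
      simp only [ht, inner_truncExp]

theorem IsFrame.linearIsometryEquiv {H K : Type*} [NormedAddCommGroup H] [InnerProductSpace ℂ H]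
    [NormedAddCommGroup K] [InnerProductSpace ℂ K] {e : ℕ → H} (he : IsFrame e) (U : H ≃ₗᵢ[ℂ] K) :
    IsFrame fun n => U (e n) := by
  obtain ⟨A, B, hA, hB, h⟩ := he
  refine ⟨A, B, hA, hB, fun f => ?_⟩
  have hin : ∀ n, inner ℂ f (U (e n)) = inner ℂ (U.symm f) (e n) := fun n => by
    conv_lhs => rw [← U.apply_symm_apply f]
    exact U.inner_map_map _ _
  simpa only [hin, U.symm.norm_map] using h (U.symm f)

/-- A Bessel sequence contains only boundedly many unit vectors that are essentially concentrated
on `[-R, R]` in time and on `[a, b]` in frequency. -/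
theorem card_le_of_concentrated {h : ℕ → Lp ℂ 2 (volume : Measure ℝ)} (h1 : ∀ n, ‖h n‖ = 1)
    {B : ℝ}
    (hB : ∀ (f : Lp ℂ 2 (volume : Measure ℝ)) (s : Finset ℕ),
      ∑ n ∈ s, ‖inner ℂ f (𝓕 (h n) : Lp ℂ 2 (volume : Measure ℝ))‖ ^ 2 ≤ B * ‖f‖ ^ 2)
    {a b R : ℝ} (hab : a ≤ b) (hR : 0 ≤ R) (s : Finset ℕ)
    (htime : ∀ n ∈ s,
      eLpNorm (h n) 2 (volume.restrict (Set.Icc (-R) R)ᶜ) ≤ ENNReal.ofReal (1 / 4))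
    (hfreq : ∀ n ∈ s, eLpNorm (𝓕 (h n) : Lp ℂ 2 (volume : Measure ℝ)) 2
      (volume.restrict (Set.Icc a b)ᶜ) ≤ ENNReal.ofReal (1 / 4)) :
    (s.card : ℝ) ≤ 8 * B * (b - a) * R := by
  -- No sign of `B` is assumed; the Bessel bound for the empty sum supplies it.
  have hB0 : 0 ≤ B * (b - a) := by
    have := hB (memLp_truncExp a b 0).toLp ∅
    rwa [Finset.sum_empty, norm_truncExp_sq hab] at this
  -- Integrate the Bessel inequality for `truncExp a b t` over `t ∈ [-R, R]`: each vector
  -- contributes at least `1/4`, and the total is at most `B (b - a)` times `2R`.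
  have key : ENNReal.ofReal (s.card * (1 / 4)) ≤ ENNReal.ofReal (B * (b - a) * (2 * R)) := by
    calc ENNReal.ofReal (s.card * (1 / 4))
        = ∑ n ∈ s, ENNReal.ofReal (1 / 4) := by
          rw [Finset.sum_const, nsmul_eq_mul, ENNReal.ofReal_mul (by positivity),
            ENNReal.ofReal_natCast]
      _ ≤ ∑ n ∈ s, ∫⁻ t in Set.Icc (-R) R, ‖inner ℂ (memLp_truncExp a b t).toLp
            (𝓕 (h n) : Lp ℂ 2 (volume : Measure ℝ))‖ₑ ^ 2 :=
          Finset.sum_le_sum fun n hn => quarter_le_setLIntegral_inner_truncExp (h1 n)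
            measurableSet_Icc (htime n hn) (hfreq n hn)
      _ = ∫⁻ t in Set.Icc (-R) R, ∑ n ∈ s, ‖inner ℂ (memLp_truncExp a b t).toLp
            (𝓕 (h n) : Lp ℂ 2 (volume : Measure ℝ))‖ₑ ^ 2 := by
          refine (lintegral_finsetSum s fun n _ => ?_).symm
          simp only [inner_truncExp]
          exact (continuous_fourierInv_of_integrable
            (integrable_indicator_Icc a b _)).measurable.enorm.pow_const 2
      _ ≤ ∫⁻ t in Set.Icc (-R) R, ENNReal.ofReal (B * (b - a)) := by
          refine lintegral_mono fun t => ?_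
          simp only [← ofReal_norm, ← ENNReal.ofReal_pow (norm_nonneg _)]
          rw [← ENNReal.ofReal_sum_of_nonneg fun n _ => by positivity, ← norm_truncExp_sq hab t]
          exact ENNReal.ofReal_le_ofReal (hB _ s)
      _ = _ := by
          rw [setLIntegral_const, Real.volume_Icc, ← ENNReal.ofReal_mul hB0]
          congr 1
          ring
  rw [ENNReal.ofReal_le_ofReal_iff (by positivity)] at key
  linarith

/-! ### Summable domination and the limit -/

theorem summable_comp_of_card_fiber_le {κ : Type*} {W : κ → ℝ} (hW : Summable W)
    (hW0 : ∀ k, 0 ≤ W k) (φ : ℕ → κ) {N : ℝ}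
    (hN : ∀ (k : κ) (s : Finset ℕ), (∀ n ∈ s, φ n = k) → (s.card : ℝ) ≤ N) :
    Summable fun n => W (φ n) := by
  classical
  refine summable_of_sum_le (c := N * ∑' k, W k) (fun n => hW0 _) fun s => ?_
  by_cases hs : s = ∅
  · subst hs
    by_cases hκ : IsEmpty κ
    · simp
    · rw [not_isEmpty_iff] at hκ
      have hN0 : 0 ≤ N := by simpa using hN hκ.some ∅ (by simp)
      simpa using mul_nonneg hN0 (tsum_nonneg hW0)
  have hN0 : 0 ≤ N := by simpa using hN (φ 0) ∅ (by simp)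
  rw [Finset.sum_comp W φ]
  calc _ ≤ ∑ k ∈ s.image φ, N * W k := Finset.sum_le_sum fun k _ => by
        rw [nsmul_eq_mul]
        exact mul_le_mul_of_nonneg_right (hN k _ (by simp)) (hW0 k)
    _ = N * ∑ k ∈ s.image φ, W k := (Finset.mul_sum _ _ _).symm
    _ ≤ _ := mul_le_mul_of_nonneg_left (hW.sum_le_tsum _ fun k _ => hW0 k) hN0

/-- The `L²` mass on `[0, 1]` of a function of spread at most `D` around `b`. -/
theorem eLpNorm_Icc_sq_le {q : ℝ} (hq : 0 ≤ q) {D : ℝ} (hD : 0 ≤ D) {h : ℝ → ℂ}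
    {b : ℝ} (hs : pSpread q h b ≤ ENNReal.ofReal D) (hb : ⌊b⌋ ∉ Finset.Icc (-1 : ℤ) 1) :
    eLpNorm h 2 (volume.restrict (Set.Icc (0 : ℝ) 1)) ^ 2 ≤
      ENNReal.ofReal (D ^ 2 * 2 ^ q * |(⌊b⌋ : ℝ)| ^ (-q)) := by
  set k := ⌊b⌋ with hk
  have hk2 : 2 ≤ |(k : ℝ)| := by
    have : 2 ≤ |k| := by
      rw [Finset.mem_Icc] at hb
      rcases le_total 0 k with h0 | h0
      · rw [abs_of_nonneg h0]; omega
      · rw [abs_of_nonpos h0]; omega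
    exact_mod_cast this
  -- The distance from `b` to `[0, 1]` is at least `|k| - 1`, and this is at least `|k| / 2` because
  -- `|k| ≥ 2`.
  have hfar : ∀ t ∈ Set.Icc (0 : ℝ) 1, |(k : ℝ)| / 2 ≤ |t - b| := by
    rintro t ⟨ht0, ht1⟩
    have hb0 := Int.floor_le b
    have hb1 := Int.lt_floor_add_one b
    rw [← hk] at hb0 hb1
    rcases le_total 0 (k : ℝ) with h0 | h0
    · rw [abs_of_nonneg h0] at hk2 ⊢
      rw [abs_of_nonpos (by linarith)]
      linarith
    · rw [abs_of_nonpos h0] at hk2 ⊢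
      rw [abs_of_nonneg (by linarith)]
      linarith
  have h1 := (ofReal_rpow_mul_eLpNorm_sq_le hq h (by positivity) measurableSet_Icc hfar).trans
    (pow_le_pow_left' hs 2)
  have hpos : 0 < (|(k : ℝ)| / 2) ^ q := by positivity
  rw [mul_comm, ← ENNReal.le_div_iff_mul_le (Or.inl (by simpa using hpos))
    (Or.inl ENNReal.ofReal_ne_top), ← ENNReal.ofReal_pow hD, ← ENNReal.ofReal_div_of_pos hpos] at h1
  refine h1.trans (le_of_eq ?_)
  congr 1
  rw [Real.div_rpow (abs_nonneg _) zero_le_two, Real.rpow_neg (abs_nonneg _)]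
  field_simp

theorem corollary4p4 (A p q : ℝ) (hA : 0 < A) (hp : 1 < p) (hq : 1 < q)
    (e : ℕ → Lp ℂ 2 (volume : Measure ℝ)) (he : ∀ n, ‖e n‖ = 1)
    (hbound : ∀ n, |pMean p (e n)| ≤ A ∧
      pDispersion p (e n) ≤ ENNReal.ofReal A ∧
      pDispersion q (𝓕 (e n) : Lp ℂ 2 (volume : Measure ℝ)) ≤ ENNReal.ofReal A) :
    ¬ IsFrame e := by
  intro hframe
  obtain ⟨c, B, hc, hB, hf⟩ := hframe.linearIsometryEquiv (Lp.fourierTransformₗᵢ ℝ ℂ)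
  have hf' : ∀ f : Lp ℂ 2 (volume : Measure ℝ),
      Summable (fun n => ‖inner ℂ f (𝓕 (e n) : Lp ℂ 2 (volume : Measure ℝ))‖ ^ 2) ∧
      c * ‖f‖ ^ 2 ≤ ∑' n, ‖inner ℂ f (𝓕 (e n) : Lp ℂ 2 (volume : Measure ℝ))‖ ^ 2 ∧
      ∑' n, ‖inner ℂ f (𝓕 (e n) : Lp ℂ 2 (volume : Measure ℝ))‖ ^ 2 ≤ B * ‖f‖ ^ 2 := hf
  have hbessel : ∀ (f : Lp ℂ 2 (volume : Measure ℝ)) (s : Finset ℕ),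
      ∑ n ∈ s, ‖inner ℂ f (𝓕 (e n) : Lp ℂ 2 (volume : Measure ℝ))‖ ^ 2 ≤ B * ‖f‖ ^ 2 :=
    fun f s => ((hf' f).1.sum_le_tsum s fun n _ => by positivity).trans (hf' f).2.2
  have hnorm : ∀ f : Lp ℂ 2 (volume : Measure ℝ), ‖f‖ = 1 → eLpNorm f 2 volume = 1 :=
    fun f h1 => by rw [← Lp.enorm_def, ← ofReal_norm, h1, ENNReal.ofReal_one]
  have hmean : ∀ n, pSpread p (e n) (pMean p (e n)) ≤ ENNReal.ofReal A := fun n =>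
    (pSpread_pMean_le (by linarith) (Lp.aestronglyMeasurable _) (hnorm _ (he n))
      ((hbound n).2.1.trans_lt ENNReal.ofReal_lt_top)).trans (hbound n).2.1
  -- A near-minimizer is enough in frequency; the slack `A + 1` makes the infimum bound strict.
  have hcenter : ∀ n, ∃ b, pSpread q (𝓕 (e n) : Lp ℂ 2 (volume : Measure ℝ)) b ≤
      ENNReal.ofReal (A + 1) := fun n => by
    obtain ⟨b, hb⟩ := iInf_lt_iff.1 ((hbound n).2.2.trans_lt
      ((ENNReal.ofReal_lt_ofReal_iff (by linarith)).2 (lt_add_one A)))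
    exact ⟨b, hb.le⟩
  choose b hb using hcenter
  obtain ⟨r, hr, htail⟩ := exists_radius_eLpNorm_le (p := p) (by linarith) hA.le
    (ε := 1 / 4) (by norm_num)
  obtain ⟨ρ, hρ, htail'⟩ := exists_radius_eLpNorm_le (p := q) (D := A + 1) (by linarith)
    (by linarith) (ε := 1 / 4) (by norm_num)
  have hcount : ∀ (k : ℤ) (s : Finset ℕ), (∀ n ∈ s, ⌊b n⌋ = k) →
      (s.card : ℝ) ≤ 8 * B * (1 + 2 * ρ) * (A + r) := fun k s hs => by
    -- Widening `[k, k + 1]` by `ρ` and `[-A, A]` by `r` puts the complements at distance at least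
    -- `ρ` and `r` from every center.
    have := card_le_of_concentrated he hbessel (a := k - ρ) (b := k + 1 + ρ) (R := A + r)
      (by linarith) (by linarith) s
      (fun n _ => htail _ _ _ measurableSet_Icc.compl (fun t ht => by
        have hμ := abs_le.1 (hbound n).1
        by_contra! hlt
        rw [abs_lt] at hlt
        exact ht ⟨by linarith, by linarith⟩) (hmean n))
      (fun n hn => htail' _ _ _ measurableSet_Icc.compl (fun t ht => by
        have h0 := Int.floor_le (b n)
        have h1 := Int.lt_floor_add_one (b n)
        rw [hs n hn] at h0 h1
        by_contra! hlt
        rw [abs_lt] at hlt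
        exact ht ⟨by linarith, by linarith⟩) (hb n))
    convert this using 3
    ring
  -- The indicator covers the centers near `[0, 1]`, where only the trivial bound `1` is used; at `k
  -- = 0` the power term is `0` by convention.
  set W : ℤ → ℝ := fun k => (A + 1) ^ 2 * 2 ^ q * |(k : ℝ)| ^ (-q) +
    (Finset.Icc (-1 : ℤ) 1 : Set ℤ).indicator 1 k
  have hW : Summable W := ((Real.summable_abs_int_rpow hq).mul_left _).add
    (summable_of_hasFiniteSupport ((Finset.finite_toSet _).subset Set.support_indicator_subset))
  have hW0 : ∀ k, 0 ≤ W k := fun k =>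
    add_nonneg (by positivity) (Set.indicator_nonneg (fun _ _ => zero_le_one) k)
  have hdom : ∀ (t : ℝ) (n : ℕ), ‖inner ℂ (memLp_truncExp 0 1 t).toLp
      (𝓕 (e n) : Lp ℂ 2 (volume : Measure ℝ))‖ ^ 2 ≤ W ⌊b n⌋ := fun t n => by
    rw [← ENNReal.ofReal_le_ofReal_iff (hW0 _), ENNReal.ofReal_pow (norm_nonneg _), ofReal_norm]
    refine (pow_le_pow_left' (norm_inner_truncExp_le t _) 2).trans ?_
    by_cases hk : ⌊b n⌋ ∈ Finset.Icc (-1 : ℤ) 1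
    · calc _ ≤ (1 : ℝ≥0∞) ^ 2 := by
            gcongr
            rw [← hnorm (𝓕 (e n)) (by rw [Lp.norm_fourier_eq, he])]
            exact eLpNorm_mono_measure _ Measure.restrict_le_self
        _ = ENNReal.ofReal 1 := by simp
        _ ≤ _ := by
            refine ENNReal.ofReal_le_ofReal ?_
            simp only [W, Set.indicator_of_mem (Finset.mem_coe.2 hk), Pi.one_apply]
            exact le_add_of_nonneg_left (by positivity)
    · refine (eLpNorm_Icc_sq_le (by linarith) (by linarith) (hb n) hk).trans
        (ENNReal.ofReal_le_ofReal ?_)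
      exact le_add_of_nonneg_right (Set.indicator_nonneg (fun _ _ => zero_le_one) _)
  have hlim : Filter.Tendsto (fun t : ℝ => ∑' n, ‖inner ℂ (memLp_truncExp 0 1 t).toLp
      (𝓕 (e n) : Lp ℂ 2 (volume : Measure ℝ))‖ ^ 2) Filter.atTop (nhds (∑' _ : ℕ, (0 : ℝ))) :=
    tendsto_tsum_of_dominated_convergence
    (summable_comp_of_card_fiber_le hW hW0 (fun n => ⌊b n⌋) hcount)
    (fun n => by simpa using (tendsto_inner_truncExp 0 1 (𝓕 (e n))).norm.pow 2)
    (Filter.Eventually.of_forall fun t n => by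
      rw [Real.norm_of_nonneg (by positivity)]
      exact hdom t n)
  rw [tsum_zero] at hlim
  have hlow : c ≤ 0 := ge_of_tendsto' hlim fun t => by
    have := (hf' (memLp_truncExp 0 1 t).toLp).2.1
    rwa [norm_truncExp_sq zero_le_one, sub_zero, mul_one] at this
  linarith
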